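/- Let $m,p\ge 1$ be integers, and let $a_n,b_n\in\mathbb C^{m\times m}$ $(n\in\mathbb Z)$ satisfy $a_{n+p}=a_n$, $b_{n+p}=b_n$ and $b_n=b_n^*$ for all $n\in\mathbb Z$. Let $\mathcal J$ be the bounded self-adjoint operator on $\ell^2(\mathbb Z,\mathbb C^m)$ given by $$(\mathcal J y)_n=a_{n-1}^*y_{n-1}+b_ny_n+a_ny_{n+1},\qquad n\in\mathbb Z .$$ Then the Lebesgue measure of its spectrum $\sigma(\mathcal J)\subset\mathbb R$ satisfies $$\operatorname{mes}(\sigma(\mathcal J))\le 4\min_{n\in\mathbb Z}\operatorname{Tr}\big((a_n^*a_n)^{1/2}\big),$$ where $(a_n^*a_n)^{1/2}$ is the positive semidefinite square root of the matrix $a_n^*a_n$. This bound is sharp for every $m$: equality holds if, for all $n$, $a_n=I_m$ is the identity matrix and $b_n=\operatorname{diag}(4k)_{k=1}^m=\operatorname{diag}(4,8,\dots,4m)$. -/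

import Mathlib

open MeasureTheory
open scoped ENNReal Matrix MatrixOrder

/-- The Hilbert space `ℓ²(ℤ, ℂᵐ)` of square-summable sequences `(yₙ)`, `n ∈ ℤ`, of vectors of the
Euclidean space `ℂᵐ`. -/
abbrev SeqSpace (m : ℕ) : Type := lp (fun _ : ℤ => EuclideanSpace ℂ (Fin m)) 2

theorem Function.Periodic.exists_norm_le {V : Type*} [NormedAddCommGroup V] {T : ℤ → V} {p : ℕ}
    (hp : 0 < p) (hT : Function.Periodic T (p : ℤ)) : ∃ C, ∀ n, ‖T n‖ ≤ C := by
  refine ⟨∑ i ∈ Finset.range p, ‖T (i : ℤ)‖, fun n => ?_⟩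
  have hp' : (0 : ℤ) < p := by exact_mod_cast hp
  have h1 : T n = T ((n % (p : ℤ)).toNat : ℤ) := by
    rw [Int.toNat_of_nonneg (Int.emod_nonneg n hp'.ne'), Int.emod_def, mul_comm]
    simpa using (hT.sub_zsmul_eq (x := n) (n / (p : ℤ))).symm
  rw [h1]
  refine Finset.single_le_sum (f := fun i : ℕ => ‖T (i : ℤ)‖) (fun i _ => norm_nonneg _) ?_
  have := Int.emod_lt_of_pos n hp'
  have := Int.emod_nonneg n hp'.ne'
  simp only [Finset.mem_range]
  omega

theorem summable_weightedShift {m : ℕ}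
    {T : ℤ → (EuclideanSpace ℂ (Fin m) →L[ℂ] EuclideanSpace ℂ (Fin m))} (k : ℤ) {C : ℝ}
    (hC : ∀ n, ‖T n‖ ≤ C) (y : SeqSpace m) :
    Summable (fun n => ‖T n (y (n + k))‖ ^ (2 : ℝ)) ∧
      ∑' n, ‖T n (y (n + k))‖ ^ (2 : ℝ) ≤ (C * ‖y‖) ^ (2 : ℝ) := by
  have hC0 : 0 ≤ C := (norm_nonneg _).trans (hC 0)
  have h2 : (0 : ℝ) < (2 : ℝ≥0∞).toReal := by norm_num
  have hs := lp.hasSum_norm h2 y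
  have hs' := ((Equiv.addRight k).hasSum_iff.mpr hs).mul_left (C ^ (2 : ℝ))
  simp only [ENNReal.toReal_ofNat] at hs'
  have hle : ∀ n, ‖T n (y (n + k))‖ ^ (2 : ℝ) ≤
      C ^ (2 : ℝ) * ((fun n => ‖y n‖ ^ (2 : ℝ)) ∘ (Equiv.addRight k)) n := by
    intro n
    simp only [Function.comp_apply, Equiv.coe_addRight]
    rw [← Real.mul_rpow hC0 (norm_nonneg _)]
    exact Real.rpow_le_rpow (norm_nonneg _)
      ((T n).le_of_opNorm_le (hC n) _) (by norm_num)
  have hsum : Summable (fun n => ‖T n (y (n + k))‖ ^ (2 : ℝ)) :=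
    Summable.of_nonneg_of_le (fun n => by positivity) hle hs'.summable
  refine ⟨hsum, ?_⟩
  rw [Real.mul_rpow hC0 (norm_nonneg _)]
  exact (hsum.tsum_le_tsum hle hs'.summable).trans_eq hs'.tsum_eq

/-- For a bounded sequence `T n` of operators on `ℂᵐ` and `k ∈ ℤ`, the bounded operator on
`ℓ²(ℤ, ℂᵐ)` that sends `y` to the sequence `n ↦ T n (y (n + k))`. -/
noncomputable def weightedShift {m : ℕ}
    (T : ℤ → (EuclideanSpace ℂ (Fin m) →L[ℂ] EuclideanSpace ℂ (Fin m))) (k : ℤ)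
    (hT : ∃ C, ∀ n, ‖T n‖ ≤ C) : SeqSpace m →L[ℂ] SeqSpace m :=
  LinearMap.mkContinuousOfExistsBound
    { toFun := fun y => ⟨fun n => T n (y (n + k)), by
        obtain ⟨C, hC⟩ := hT
        exact memℓp_gen (by simpa using (summable_weightedShift k hC y).1)⟩
      map_add' := fun y z => by ext n : 2; simp; rfl
      map_smul' := fun c y => by ext n : 2; simp }
    (by
      obtain ⟨C, hC⟩ := hT
      refine ⟨C, fun y => ?_⟩
      have hC0 : 0 ≤ C := (norm_nonneg _).trans (hC 0)
      refine lp.norm_le_of_tsum_le (by norm_num) (by positivity) ?_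
      simpa using (summable_weightedShift k hC y).2)

@[simp]
theorem weightedShift_apply {m : ℕ}
    (T : ℤ → (EuclideanSpace ℂ (Fin m) →L[ℂ] EuclideanSpace ℂ (Fin m))) (k : ℤ)
    (hT : ∃ C, ∀ n, ‖T n‖ ≤ C) (y : SeqSpace m) (n : ℤ) :
    weightedShift T k hT y n = T n (y (n + k)) := rfl

/-- The `p`-periodic Jacobi operator `J` on `ℓ²(ℤ, ℂᵐ)` with coefficients `aₙ, bₙ ∈ ℂᵐˣᵐ`,
`(J y)ₙ = aₙ₋₁* yₙ₋₁ + bₙ yₙ + aₙ yₙ₊₁` (see `jacobiOperator_apply`). It is self-adjoint if all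
`bₙ` are Hermitian (see `isSelfAdjoint_jacobiOperator`). -/
noncomputable def jacobiOperator {m : ℕ} (p : ℕ) (hp : 0 < p)
    (a b : ℤ → Matrix (Fin m) (Fin m) ℂ)
    (ha : Function.Periodic a (p : ℤ)) (hb : Function.Periodic b (p : ℤ)) :
    SeqSpace m →L[ℂ] SeqSpace m :=
  weightedShift (fun n => Matrix.toEuclideanCLM (𝕜 := ℂ) (a (n - 1))ᴴ) (-1)
      (Function.Periodic.exists_norm_le hp fun n => by
        rw [show n + (p : ℤ) - 1 = n - 1 + p by ring, ha (n - 1)]) +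
    weightedShift (fun n => Matrix.toEuclideanCLM (𝕜 := ℂ) (b n)) 0
      (Function.Periodic.exists_norm_le hp fun n => by rw [hb n]) +
    weightedShift (fun n => Matrix.toEuclideanCLM (𝕜 := ℂ) (a n)) 1
      (Function.Periodic.exists_norm_le hp fun n => by rw [ha n])

theorem jacobiOperator_apply {m : ℕ} (p : ℕ) (hp : 0 < p)
    (a b : ℤ → Matrix (Fin m) (Fin m) ℂ)
    (ha : Function.Periodic a (p : ℤ)) (hb : Function.Periodic b (p : ℤ))
    (y : SeqSpace m) (n : ℤ) :
    (jacobiOperator p hp a b ha hb y n).ofLp =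
      (a (n - 1))ᴴ *ᵥ (y (n - 1)).ofLp + b n *ᵥ (y n).ofLp + a n *ᵥ (y (n + 1)).ofLp := by
  simp [jacobiOperator, sub_eq_add_neg]

theorem inner_weightedShift {m : ℕ}
    (T S : ℤ → (EuclideanSpace ℂ (Fin m) →L[ℂ] EuclideanSpace ℂ (Fin m))) (k : ℤ)
    (hT : ∃ C, ∀ n, ‖T n‖ ≤ C) (hS : ∃ C, ∀ n, ‖S n‖ ≤ C)
    (hTS : ∀ n, S (n + k) = star (T n)) (y z : SeqSpace m) :
    inner ℂ (weightedShift T k hT y) z = inner ℂ y (weightedShift S (-k) hS z) := by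
  rw [lp.inner_eq_tsum, lp.inner_eq_tsum,
    ← (Equiv.addRight k).tsum_eq (fun n => inner ℂ (y n) (weightedShift S (-k) hS z n))]
  refine tsum_congr fun n => ?_
  simp [hTS, ContinuousLinearMap.star_eq_adjoint, ContinuousLinearMap.adjoint_inner_right]

theorem isSelfAdjoint_jacobiOperator {m : ℕ} (p : ℕ) (hp : 0 < p)
    (a b : ℤ → Matrix (Fin m) (Fin m) ℂ)
    (ha : Function.Periodic a (p : ℤ)) (hb : Function.Periodic b (p : ℤ))
    (hb' : ∀ n, (b n).IsHermitian) : IsSelfAdjoint (jacobiOperator p hp a b ha hb) := by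
  rw [ContinuousLinearMap.isSelfAdjoint_iff_isSymmetric]
  intro y z
  simp only [jacobiOperator, ContinuousLinearMap.coe_coe, add_apply,
    inner_add_left, inner_add_right]
  rw [inner_weightedShift (fun n => Matrix.toEuclideanCLM (𝕜 := ℂ) (a (n - 1))ᴴ)
      (fun n => Matrix.toEuclideanCLM (𝕜 := ℂ) (a n)) (-1) _
      (Function.Periodic.exists_norm_le hp fun n => by rw [ha n])
      (fun n => by rw [← map_star, Matrix.star_eq_conjTranspose,
        Matrix.conjTranspose_conjTranspose, sub_eq_add_neg]),
    inner_weightedShift (fun n => Matrix.toEuclideanCLM (𝕜 := ℂ) (b n))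
      (fun n => Matrix.toEuclideanCLM (𝕜 := ℂ) (b n)) 0 _
      (Function.Periodic.exists_norm_le hp fun n => by rw [hb n])
      (fun n => by rw [← map_star, Matrix.star_eq_conjTranspose, (hb' n).eq, add_zero]),
    inner_weightedShift (fun n => Matrix.toEuclideanCLM (𝕜 := ℂ) (a n))
      (fun n => Matrix.toEuclideanCLM (𝕜 := ℂ) (a (n - 1))ᴴ) 1 _
      (Function.Periodic.exists_norm_le hp fun n => by
        rw [show n + (p : ℤ) - 1 = n - 1 + p by ring, ha (n - 1)])
      (fun n => by rw [← map_star, Matrix.star_eq_conjTranspose, add_sub_cancel_right])]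
  simp only [neg_neg, neg_zero]
  ring

/-- The Lebesgue measure of the spectrum of an operator on `ℓ²(ℤ, ℂᵐ)` whose spectrum is real,
such as a self-adjoint operator. -/
noncomputable def spectrumMeasure {m : ℕ} (J : SeqSpace m →L[ℂ] SeqSpace m) : ℝ≥0∞ :=
  volume {x : ℝ | (x : ℂ) ∈ spectrum ℂ J}

/-- `Tr ((A* A)^{1/2})`, where `(A* A)^{1/2}` is the positive semidefinite square root of
`A* A`; this trace is a nonnegative real number. -/
noncomputable def traceAbs {m : ℕ} (A : Matrix (Fin m) (Fin m) ℂ) : ℝ :=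
  (Matrix.trace (CFC.sqrt (Aᴴ * A))).re

/-! Fix `n` and cut the line at the bond `n` of every period. The Jacobi operator becomes a direct
sum of copies of one finite block `A`, coupled only through `a n`. By the singular value
decomposition (`exists_abs_re_inner_le_traceAbs`) each coupling is bounded by a diagonal form at the
two sites it joins. Hence `A - D ≤ J ≤ A + D` cell by cell, with one `D ≥ 0` of trace at most `2 Tr
|a n|` (`exists_cell_bounds`).

Let `x` be such that at least as many eigenvalues of `A + D` lie below `x` as eigenvalues of `A - D`
lie at or below `x`. Then the cell splits into a subspace where `A - D > x` and one where `A + D <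
x`. Applied in all cells at once, this splits every sequence into a part where `J > x` and a part
where `J < x`, so `x` is not in the spectrum. The remaining `x` have measure at most the integral of
the difference of the two counting functions, which is `tr (A + D) - tr (A - D) = 2 tr D ≤ 4 Tr |a
n|` (`exists_measure_le_trace_sub`).

In the example the scalar components have the spectral bands `[4k - 2, 4k + 2]`, `1 ≤ k ≤ m`, which
touch only at endpoints and have total length `4m`. -/

section FiniteDimensional

/-! ### Eigenvalue counting for two ordered symmetric operators -/

variable {E : Type*} [NormedAddCommGroup E] [InnerProductSpace ℂ E] [FiniteDimensional ℂ E]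

theorem LinearMap.exists_norm_apply_le (q : E →ₗ[ℂ] E) : ∃ C : ℝ, ∀ c, ‖q c‖ ≤ C * ‖c‖ :=
  ⟨_, q.toContinuousLinearMap.le_opNorm⟩

theorem LinearMap.IsSymmetric.re_inner_eq_sum {T : E →ₗ[ℂ] E} (hT : T.IsSymmetric)
    {d : ℕ} (hd : Module.finrank ℂ E = d) (v : E) :
    (inner ℂ (T v) v).re =
      ∑ j, hT.eigenvalues hd j * ‖inner ℂ (hT.eigenvectorBasis hd j) v‖ ^ 2 := by
  rw [← (hT.eigenvectorBasis hd).sum_inner_mul_inner, Complex.re_sum]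
  refine Finset.sum_congr rfl fun j _ => ?_
  rw [hT, hT.apply_eigenvectorBasis, inner_smul_right, mul_assoc, ← inner_conj_symm v,
    ← Complex.normSq_eq_conj_mul_self, Complex.normSq_eq_norm_sq]
  simp [-Complex.ofReal_pow]

/-- The span of a set of eigenvectors of a symmetric operator, with the bounds of its quadratic
form there. -/
theorem LinearMap.IsSymmetric.exists_submodule_of_finset {T : E →ₗ[ℂ] E} (hT : T.IsSymmetric)
    {d : ℕ} (hd : Module.finrank ℂ E = d) (S : Finset (Fin d)) :
    ∃ V : Submodule ℂ E, Module.finrank ℂ V = S.card ∧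
      (∀ c : ℝ, (∀ j ∈ S, hT.eigenvalues hd j ≤ c) →
        ∀ v ∈ V, (inner ℂ (T v) v).re ≤ c * ‖v‖ ^ 2) ∧
      (∀ c : ℝ, (∀ j ∈ S, c ≤ hT.eigenvalues hd j) →
        ∀ v ∈ V, c * ‖v‖ ^ 2 ≤ (inner ℂ (T v) v).re) := by
  set b := hT.eigenvectorBasis hd with hb
  have hli : LinearIndependent ℂ (fun j : S => b j) :=
    b.orthonormal.linearIndependent.comp _ Subtype.val_injective
  have hV : ∀ v ∈ Submodule.span ℂ (Set.range fun j : S => b j), ∀ j ∉ S, inner ℂ (b j) v = 0 := by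
    intro v hv j hj
    induction hv using Submodule.span_induction with
    | mem x hx =>
      obtain ⟨i, rfl⟩ := hx
      exact b.orthonormal.2 fun h => hj (h ▸ i.2)
    | zero => simp
    | add x y _ _ hx hy => rw [inner_add_right, hx, hy, add_zero]
    | smul a x _ hx => rw [inner_smul_right, hx, mul_zero]
  refine ⟨Submodule.span ℂ (Set.range fun j : S => b j), ?_, fun c hc v hv => ?_,
    fun c hc v hv => ?_⟩
  · rw [finrank_span_eq_card hli, Fintype.card_coe]
  all_goals
    rw [hT.re_inner_eq_sum hd, ← b.sum_sq_norm_inner_right, Finset.mul_sum]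
    refine Finset.sum_le_sum fun j _ => ?_
    by_cases hj : j ∈ S
    · exact mul_le_mul_of_nonneg_right (hc j hj) (by positivity)
    · simp [← hb, hV v hv j hj]

/-- The spectral subspaces `V` of `T` below `x` and `U` of `S` above `x` meet only in `0`, because
`S ≤ T`; comparing dimensions gives the inequality of the counts. If the counts agree, `U` and `V`
are complementary, and `q` is the projection onto `U` along `V`, in general not orthogonal. -/
theorem exists_projection_of_card_le {S T : E →ₗ[ℂ] E} (hS : S.IsSymmetric) (hT : T.IsSymmetric)
    (hST : ∀ v, (inner ℂ (S v) v).re ≤ (inner ℂ (T v) v).re)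
    {d : ℕ} (hd : Module.finrank ℂ E = d) (x : ℝ)  :
    (Finset.univ.filter fun j => hT.eigenvalues hd j < x).card ≤
      (Finset.univ.filter fun j => hS.eigenvalues hd j ≤ x).card ∧
    ((Finset.univ.filter fun j => hS.eigenvalues hd j ≤ x).card ≤
      (Finset.univ.filter fun j => hT.eigenvalues hd j < x).card →
      ∃ q : E →ₗ[ℂ] E, ∃ δ > 0, ∀ v,
        δ * ‖q v‖ ^ 2 ≤ (inner ℂ (S (q v)) (q v)).re - x * ‖q v‖ ^ 2 ∧
        (inner ℂ (T (v - q v)) (v - q v)).re - x * ‖v - q v‖ ^ 2 ≤ -(δ * ‖v - q v‖ ^ 2)) := by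
  obtain ⟨V, hVd, hV, -⟩ := hT.exists_submodule_of_finset hd
    (Finset.univ.filter fun j => hT.eigenvalues hd j < x)
  obtain ⟨U, hUd, -, hU⟩ := hS.exists_submodule_of_finset hd
    (Finset.univ.filter fun j => ¬ hS.eigenvalues hd j ≤ x)
  have hcard := Finset.card_filter_add_card_filter_not (s := Finset.univ)
    (fun j => hS.eigenvalues hd j ≤ x)
  rw [Finset.card_univ, Fintype.card_fin, ← hUd] at hcard
  -- Finitely many eigenvalues, so a single gap `δ` serves all of them.
  obtain ⟨δ, hδ, hδV, hδU⟩ : ∃ δ > 0, (∀ v ∈ V, (inner ℂ (T v) v).re ≤ (x - δ) * ‖v‖ ^ 2) ∧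
      ∀ v ∈ U, (x + δ) * ‖v‖ ^ 2 ≤ (inner ℂ (S v) v).re := by
    have h1 : ∀ᶠ δ in nhdsWithin (0 : ℝ) (Set.Ioi 0), ∀ j, hT.eigenvalues hd j < x →
        hT.eigenvalues hd j ≤ x - δ := by
      rw [Filter.eventually_all]
      intro j
      by_cases h : hT.eigenvalues hd j < x
      · filter_upwards [Ioo_mem_nhdsGT (sub_pos.2 h)] with δ hδ _
        linarith [hδ.2]
      · exact Filter.Eventually.of_forall fun _ h' => absurd h' h
    have h2 : ∀ᶠ δ in nhdsWithin (0 : ℝ) (Set.Ioi 0), ∀ j, ¬ hS.eigenvalues hd j ≤ x →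
        x + δ ≤ hS.eigenvalues hd j := by
      rw [Filter.eventually_all]
      intro j
      by_cases h : hS.eigenvalues hd j ≤ x
      · exact Filter.Eventually.of_forall fun _ h' => absurd h h'
      · filter_upwards [Ioo_mem_nhdsGT (sub_pos.2 (not_le.1 h))] with δ hδ _
        linarith [hδ.2]
    obtain ⟨δ, ⟨h1, h2⟩, hδ⟩ := ((h1.and h2).and self_mem_nhdsWithin).exists
    exact ⟨δ, hδ, hV _ (by simpa using h1), hU _ (by simpa using h2)⟩
  have hdisj : Disjoint V U := by
    rw [Submodule.disjoint_def]
    intro v hvV hvU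
    have h1 := hδV v hvV
    have h2 := hδU v hvU
    have h3 := hST v
    have : ‖v‖ ^ 2 ≤ 0 := by nlinarith
    simpa using le_antisymm this (by positivity)
  have hle := Submodule.finrank_add_finrank_le_of_disjoint hdisj
  rw [hVd, hd] at hle
  refine ⟨by omega, fun hgood => ?_⟩
  have hcompl : IsCompl U V :=
    ⟨hdisj.symm, codisjoint_iff.2 (Submodule.eq_top_of_disjoint U V (by omega) hdisj.symm)⟩
  refine ⟨U.projection V hcompl, δ, hδ, fun v => ⟨?_, ?_⟩⟩
  · have := hδU _ (Submodule.projection_apply_mem hcompl v)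
    linarith
  · have hm : v - U.projection V hcompl v ∈ V := by
      rw [← Submodule.projection_apply_eq_zero_iff hcompl, map_sub, sub_eq_zero,
        Submodule.projection_apply_of_mem_left hcompl (Submodule.projection_apply_mem hcompl v)]
    have := hδV _ hm
    linarith

/-- If `S ≤ T`, then outside a set of measure at most `tr T - tr S` every real `x` admits a
splitting of the space into a part on which `S > x` and a part on which `T < x`. -/
theorem exists_measure_le_trace_sub {S T : E →ₗ[ℂ] E} (hS : S.IsSymmetric) (hT : T.IsSymmetric)
    (hST : ∀ v, (inner ℂ (S v) v).re ≤ (inner ℂ (T v) v).re) :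
    ∃ B : Set ℝ, volume B ≤
        ENNReal.ofReal ((LinearMap.trace ℂ E T).re - (LinearMap.trace ℂ E S).re) ∧
      ∀ x ∉ B, ∃ q : E →ₗ[ℂ] E, ∃ δ > 0, ∀ v,
        δ * ‖q v‖ ^ 2 ≤ (inner ℂ (S (q v)) (q v)).re - x * ‖q v‖ ^ 2 ∧
        (inner ℂ (T (v - q v)) (v - q v)).re - x * ‖v - q v‖ ^ 2 ≤ -(δ * ‖v - q v‖ ^ 2) := by
  set d := Module.finrank ℂ E with hd
  set s := hS.eigenvalues hd.symm
  set t := hT.eigenvalues hd.symm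
  obtain ⟨R, hRs, hRt⟩ : ∃ R : ℝ, (∀ j, |s j| ≤ R) ∧ ∀ j, |t j| ≤ R := by
    refine ⟨∑ j, |s j| + ∑ j, |t j|, fun j => ?_, fun j => ?_⟩
    · have := Finset.single_le_sum (f := fun j => |s j|) (fun i _ => abs_nonneg _)
        (Finset.mem_univ j)
      have : 0 ≤ ∑ j, |t j| := Finset.sum_nonneg fun _ _ => abs_nonneg _
      linarith
    · have := Finset.single_le_sum (f := fun j => |t j|) (fun i _ => abs_nonneg _)
        (Finset.mem_univ j)
      have : 0 ≤ ∑ j, |s j| := Finset.sum_nonneg fun _ _ => abs_nonneg _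
      linarith
  -- The exceptional set: the counts differ, so the two spectral subspaces do not fill the space.
  set B : Set ℝ := {x | (Finset.univ.filter fun j => t j < x).card <
    (Finset.univ.filter fun j => s j ≤ x).card} with hB
  refine ⟨B, ?_, fun x hx =>
    (exists_projection_of_card_le hS hT hST hd.symm x).2 (not_lt.1 hx)⟩
  have hmono := fun x => (exists_projection_of_card_le hS hT hST hd.symm x).1
  have hBR : B ⊆ Set.Icc (-R) R := by
    intro x hx
    constructor
    · by_contra h
      have : (Finset.univ.filter fun j => s j ≤ x) = ∅ := by
        refine Finset.filter_false_of_mem fun j _ => ?_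
        have := neg_le_of_abs_le (hRs j)
        linarith
      simp [hB, this] at hx
    · by_contra h
      have : (Finset.univ.filter fun j => t j < x) = Finset.univ := by
        refine Finset.filter_true_of_mem fun j _ => ?_
        have := le_of_abs_le (hRt j)
        linarith
      rw [hB, Set.mem_ofPred_eq, this] at hx
      exact absurd (Finset.card_le_univ _) (not_le.2 hx)
  -- The counts are integers, so they differ by at least 1 on `B`. Truncating at `R` makes the
  -- integrals finite; `Ioc` and `Icc` reproduce the strict and the weak inequality in the two
  -- counts.
  have hpt : ∀ x, B.indicator (1 : ℝ → ℝ≥0∞) x +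
      ∑ j, (Set.Ioc (t j) R).indicator (1 : ℝ → ℝ≥0∞) x ≤
      ∑ j, (Set.Icc (s j) R).indicator (1 : ℝ → ℝ≥0∞) x := by
    intro x
    by_cases hxR : x ≤ R
    · have h1 : ∑ j, (Set.Ioc (t j) R).indicator (1 : ℝ → ℝ≥0∞) x =
          ((Finset.univ.filter fun j => t j < x).card : ℝ≥0∞) := by
        simp [Set.indicator_apply, hxR]
      have h2 : ∑ j, (Set.Icc (s j) R).indicator (1 : ℝ → ℝ≥0∞) x =
          ((Finset.univ.filter fun j => s j ≤ x).card : ℝ≥0∞) := by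
        simp [Set.indicator_apply, hxR]
      rw [h1, h2]
      by_cases hx : x ∈ B
      · rw [Set.indicator_of_mem hx, Pi.one_apply, add_comm]
        exact_mod_cast hx
      · rw [Set.indicator_of_notMem hx, zero_add]
        exact_mod_cast hmono x
    · have hx : x ∉ B := fun h => hxR (hBR h).2
      simp [hxR, hx]
  have hBm : MeasurableSet B := by
    simp only [hB, Finset.card_filter]
    exact measurableSet_lt
      (Finset.measurable_sum _ fun j _ => Measurable.ite measurableSet_Ioi measurable_const
        measurable_const)
      (Finset.measurable_sum _ fun j _ => Measurable.ite measurableSet_Ici measurable_const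
        measurable_const)
  have hint := lintegral_mono (μ := volume) hpt
  rw [lintegral_add_left (measurable_one.indicator hBm), lintegral_indicator_one hBm,
    lintegral_finsetSum _ fun j _ => measurable_one.indicator measurableSet_Ioc,
    lintegral_finsetSum _ fun j _ => measurable_one.indicator measurableSet_Icc] at hint
  simp_rw [lintegral_indicator_one measurableSet_Ioc, lintegral_indicator_one measurableSet_Icc,
    Real.volume_Ioc, Real.volume_Icc] at hint
  rw [← ENNReal.ofReal_sum_of_nonneg fun j _ => sub_nonneg.2 (le_of_abs_le (hRt j)),
    ← ENNReal.ofReal_sum_of_nonneg fun j _ => sub_nonneg.2 (le_of_abs_le (hRs j))] at hint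
  have hts : (LinearMap.trace ℂ E T).re = ∑ j, t j := hT.re_trace_eq_sum_eigenvalues hd.symm
  have hss : (LinearMap.trace ℂ E S).re = ∑ j, s j := hS.re_trace_eq_sum_eigenvalues hd.symm
  rw [hts, hss]
  have := ENNReal.le_sub_of_add_le_right ENNReal.ofReal_ne_top hint
  rw [← ENNReal.ofReal_sub _ (Finset.sum_nonneg fun j _ => sub_nonneg.2 (le_of_abs_le (hRt j)))]
    at this
  refine this.trans_eq ?_
  congr 1
  simp only [Finset.sum_sub_distrib]
  ring

/-- The operator is a sum of rank-one operators, with trace `∑ s j * ‖u j‖ ^ 2`. Vectors of norm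
less than 1 are admitted because a singular vector that belongs to the singular value `0` may be
taken to be `0`. -/
theorem exists_isSymmetric_re_inner_eq_sum {ι : Type*} [Fintype ι] (s : ι → ℝ)
    (u : ι → E) (hs : ∀ j, 0 ≤ s j) (hu : ∀ j, ‖u j‖ ≤ 1) :
    ∃ D : E →ₗ[ℂ] E, D.IsSymmetric ∧ (LinearMap.trace ℂ E D).re ≤ ∑ j, s j ∧
      ∀ c, (inner ℂ (D c) c).re = ∑ j, s j * ‖inner ℂ (u j) c‖ ^ 2 := by
  refine ⟨∑ j, (s j : ℂ) • (InnerProductSpace.rankOne ℂ (u j) (u j)).toLinearMap, ?_, ?_, ?_⟩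
  · intro c d
    simp only [LinearMap.sum_apply, LinearMap.smul_apply, ContinuousLinearMap.coe_coe,
      InnerProductSpace.rankOne_apply, sum_inner, inner_sum, inner_smul_left, inner_smul_right,
      Complex.conj_ofReal, inner_conj_symm]
    exact Finset.sum_congr rfl fun j _ => by ring
  · rw [map_sum, Complex.re_sum]
    refine Finset.sum_le_sum fun j _ => ?_
    rw [map_smul, InnerProductSpace.trace_rankOne, smul_eq_mul, Complex.re_ofReal_mul,
      inner_self_eq_norm_sq_to_K]
    have h : ‖u j‖ ^ 2 ≤ 1 := pow_le_one₀ (norm_nonneg _) (hu j)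
    have := mul_le_mul_of_nonneg_left h (hs j)
    rw [mul_one] at this
    exact_mod_cast this
  · intro c
    simp only [LinearMap.sum_apply, LinearMap.smul_apply, ContinuousLinearMap.coe_coe,
      InnerProductSpace.rankOne_apply, sum_inner, inner_smul_left, Complex.conj_ofReal,
      Complex.re_sum, Complex.re_ofReal_mul]
    refine Finset.sum_congr rfl fun j _ => ?_
    rw [← Complex.normSq_eq_conj_mul_self, Complex.ofReal_re, Complex.normSq_eq_norm_sq]

/-- A symmetric operator `A` perturbed by diagonal forms `±(D₀ + D₁)` with weights `s`: up to a set
of measure `4 ∑ s`, every real `x` admits a splitting of the space into a part on which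
`A - (D₀ + D₁) > x` and a part on which `A + (D₀ + D₁) < x`. -/
theorem LinearMap.IsSymmetric.exists_splitting_of_perturbation {A : E →ₗ[ℂ] E}
    (hA : A.IsSymmetric) {ι : Type*} [Fintype ι] {s : ι → ℝ} {u w : ι → E} (hs : ∀ j, 0 ≤ s j)
    (hu : ∀ j, ‖u j‖ ≤ 1) (hw : ∀ j, ‖w j‖ ≤ 1) :
    ∃ D₀ D₁ : E →ₗ[ℂ] E, (∀ c, (inner ℂ (D₀ c) c).re = ∑ j, s j * ‖inner ℂ (u j) c‖ ^ 2) ∧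
      (∀ c, (inner ℂ (D₁ c) c).re = ∑ j, s j * ‖inner ℂ (w j) c‖ ^ 2) ∧
      ∃ B : Set ℝ, volume B ≤ ENNReal.ofReal (4 * ∑ j, s j) ∧
        ∀ x ∉ B, ∃ q : E →ₗ[ℂ] E, ∃ δ > 0, ∀ v,
          δ * ‖q v‖ ^ 2 ≤ (inner ℂ ((A - (D₀ + D₁)) (q v)) (q v)).re - x * ‖q v‖ ^ 2 ∧
          (inner ℂ ((A + (D₀ + D₁)) (v - q v)) (v - q v)).re - x * ‖v - q v‖ ^ 2 ≤
            -(δ * ‖v - q v‖ ^ 2) := by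
  obtain ⟨D₀, hD₀, htr₀, hq₀⟩ := exists_isSymmetric_re_inner_eq_sum s u hs hu
  obtain ⟨D₁, hD₁, htr₁, hq₁⟩ := exists_isSymmetric_re_inner_eq_sum s w hs hw
  obtain ⟨B, hB, hBq⟩ := exists_measure_le_trace_sub (hA.sub (hD₀.add hD₁))
    (hA.add (hD₀.add hD₁)) fun c => by
      have h₀ : 0 ≤ (inner ℂ (D₀ c) c).re := by
        rw [hq₀]; exact Finset.sum_nonneg fun j _ => mul_nonneg (hs j) (by positivity)
      have h₁ : 0 ≤ (inner ℂ (D₁ c) c).re := by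
        rw [hq₁]; exact Finset.sum_nonneg fun j _ => mul_nonneg (hs j) (by positivity)
      simp only [LinearMap.sub_apply, LinearMap.add_apply, inner_sub_left, inner_add_left,
        Complex.sub_re, Complex.add_re]
      linarith
  refine ⟨D₀, D₁, hq₀, hq₁, B, hB.trans (ENNReal.ofReal_le_ofReal ?_), hBq⟩
  simp only [map_sub, map_add, Complex.sub_re, Complex.add_re]
  linarith

end FiniteDimensional

/-! ### Singular values of the cut bond -/

theorem Matrix.inner_toEuclideanCLM_conjTranspose {m : ℕ} (A : Matrix (Fin m) (Fin m) ℂ)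
    (x y : EuclideanSpace ℂ (Fin m)) :
    inner ℂ (Matrix.toEuclideanCLM (𝕜 := ℂ) Aᴴ x) y =
      inner ℂ x (Matrix.toEuclideanCLM (𝕜 := ℂ) A y) := by
  rw [← Matrix.star_eq_conjTranspose, map_star, ContinuousLinearMap.star_eq_adjoint,
    ContinuousLinearMap.adjoint_inner_left]

open scoped ComplexOrder in
/-- The singular value decomposition of `A` bounds its sesquilinear form by a diagonal form whose
weights sum up to `Tr |A|`. -/
theorem exists_abs_re_inner_le_traceAbs {m : ℕ} (A : Matrix (Fin m) (Fin m) ℂ) :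
    ∃ (s : Fin m → ℝ) (u w : Fin m → EuclideanSpace ℂ (Fin m)),
      (∀ j, 0 ≤ s j) ∧ ∑ j, s j = traceAbs A ∧ (∀ j, ‖u j‖ ≤ 1) ∧ (∀ j, ‖w j‖ ≤ 1) ∧
      ∀ x y, |2 * (inner ℂ (Matrix.toEuclideanCLM (𝕜 := ℂ) A y) x).re| ≤
        ∑ j, s j * ‖inner ℂ (u j) y‖ ^ 2 + ∑ j, s j * ‖inner ℂ (w j) x‖ ^ 2 := by
  set R := CFC.sqrt (Aᴴ * A) with hR
  have hRpos : R.PosSemidef := Matrix.nonneg_iff_posSemidef.1 (CFC.sqrt_nonneg (Aᴴ * A))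
  have hRR : R * R = Aᴴ * A :=
    CFC.sqrt_mul_sqrt_self _ (Matrix.posSemidef_conjTranspose_mul_self A).nonneg
  have hH := hRpos.isHermitian
  set s := hH.eigenvalues with hs
  set u := hH.eigenvectorBasis with hu
  have hRu : ∀ j, Matrix.toEuclideanCLM (𝕜 := ℂ) R (u j) = (s j : ℂ) • u j := by
    intro j
    ext i
    have := congrFun (hH.mulVec_eigenvectorBasis j) i
    simpa [Matrix.ofLp_toEuclideanCLM] using this
  have hs0 : ∀ j, 0 ≤ s j := hRpos.eigenvalues_nonneg
  have hAu : ∀ j, ‖Matrix.toEuclideanCLM (𝕜 := ℂ) A (u j)‖ = s j := by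
    intro j
    have h1 : inner ℂ (Matrix.toEuclideanCLM (𝕜 := ℂ) A (u j))
        (Matrix.toEuclideanCLM (𝕜 := ℂ) A (u j)) =
        inner ℂ (Matrix.toEuclideanCLM (𝕜 := ℂ) R (u j))
          (Matrix.toEuclideanCLM (𝕜 := ℂ) R (u j)) := by
      rw [← Matrix.inner_toEuclideanCLM_conjTranspose, ← Matrix.inner_toEuclideanCLM_conjTranspose,
        ← mul_apply_eq_comp, ← mul_apply_eq_comp, ← map_mul, ← map_mul,
        hH.eq, hRR]
    rw [inner_self_eq_norm_sq_to_K, inner_self_eq_norm_sq_to_K, hRu, norm_smul,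
      u.orthonormal.1 j, mul_one] at h1
    have h2 : ‖Matrix.toEuclideanCLM (𝕜 := ℂ) A (u j)‖ ^ 2 = s j ^ 2 := by
      simp only [Complex.norm_real, Real.norm_eq_abs] at h1
      rw [← sq_abs (s j)]
      exact_mod_cast h1
    exact (sq_eq_sq₀ (norm_nonneg _) (hs0 j)).1 h2
  -- For `s j = 0` the convention `0⁻¹ = 0` gives `w j = 0`, which is harmless since then `A (u j) =
  -- 0`.
  set w : Fin m → EuclideanSpace ℂ (Fin m) :=
    fun j => ((s j)⁻¹ : ℂ) • Matrix.toEuclideanCLM (𝕜 := ℂ) A (u j) with hw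
  have hsw : ∀ j, Matrix.toEuclideanCLM (𝕜 := ℂ) A (u j) = (s j : ℂ) • w j := by
    intro j
    by_cases h : s j = 0
    · have := hAu j
      rw [h, norm_eq_zero] at this
      rw [this, h, Complex.ofReal_zero, zero_smul]
    · rw [hw, smul_smul, mul_inv_cancel₀ (by exact_mod_cast h), one_smul]
  refine ⟨s, u, w, hs0, ?_, fun j => (u.orthonormal.1 j).le, fun j => ?_, fun x y => ?_⟩
  · rw [traceAbs, ← hR, hH.trace_eq_sum_eigenvalues]
    simp [hs]
  · rw [hw, norm_smul, hAu, norm_inv, Complex.norm_real, Real.norm_of_nonneg (hs0 j)]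
    exact inv_mul_le_one
  · have hy : Matrix.toEuclideanCLM (𝕜 := ℂ) A y = ∑ j, (inner ℂ (u j) y * s j) • w j := by
      conv_lhs => rw [← u.sum_repr' y]
      simp only [map_sum, map_smul, hsw, smul_smul]
    rw [hy, sum_inner, Complex.re_sum, Finset.mul_sum, ← Finset.sum_add_distrib]
    refine (Finset.abs_sum_le_sum_abs _ _).trans (Finset.sum_le_sum fun j _ => ?_)
    rw [inner_smul_left, abs_mul, abs_two]
    have h1 := Complex.abs_re_le_norm
      ((starRingEnd ℂ) (inner ℂ (u j) y * (s j : ℂ)) * inner ℂ (w j) x)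
    rw [norm_mul, RCLike.norm_conj, norm_mul, Complex.norm_real, Real.norm_of_nonneg (hs0 j)] at h1
    -- `2αβ ≤ α² + β²`, weighted by `s j`.
    nlinarith [mul_nonneg (hs0 j) (sq_nonneg (‖inner ℂ (u j) y‖ - ‖inner ℂ (w j) x‖))]

/-! ### A resolvent criterion -/

/-- A self-adjoint operator `J` has `x` in its resolvent set if every vector splits into a part on
which `J` is above `x` and a part on which `J` is below `x`. -/
theorem IsSelfAdjoint.notMem_spectrum_of_splitting {H : Type*} [NormedAddCommGroup H]
    [InnerProductSpace ℂ H] [CompleteSpace H] {J : H →L[ℂ] H} (hJ : IsSelfAdjoint J) {x δ : ℝ}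
    (hδ : 0 < δ)
    (h : ∀ v, ∃ w, δ * ‖w‖ ^ 2 ≤ (inner ℂ (J w) w).re - x * ‖w‖ ^ 2 ∧
      (inner ℂ (J (v - w)) (v - w)).re - x * ‖v - w‖ ^ 2 ≤ -(δ * ‖v - w‖ ^ 2)) :
    (x : ℂ) ∉ spectrum ℂ J := by
  set T : H →L[ℂ] H := J - algebraMap ℂ _ (x : ℂ) with hTdef
  have hTapp : ∀ v, T v = J v - (x : ℂ) • v := fun v => by
    simp [hTdef, Algebra.algebraMap_eq_smul_one]
  have hT : IsSelfAdjoint T := hJ.sub (by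
    rw [IsSelfAdjoint, ← algebraMap_star_comm, ← starRingEnd_apply, Complex.conj_ofReal])
  have hTre : ∀ v, (inner ℂ (T v) v).re = (inner ℂ (J v) v).re - x * ‖v‖ ^ 2 := fun v => by
    rw [hTapp, inner_sub_left, inner_smul_left, Complex.sub_re, Complex.conj_ofReal,
      Complex.re_ofReal_mul, inner_self_eq_norm_sq_to_K]
    norm_cast
  have hTsymm := hT.isSymmetric
  have hbelow : ∀ v, δ / 2 * ‖v‖ ≤ ‖T v‖ := by
    intro v
    obtain ⟨w, h1, h2⟩ := h v
    rw [← hTre] at h1 h2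
    set z := v - w with hz
    have hv : v = w + z := by rw [hz]; abel
    have hcross : (inner ℂ (T w) z).re = (inner ℂ (T z) w).re := by
      have : inner ℂ (T w) z = inner ℂ w (T z) := hTsymm w z
      rw [this, ← inner_conj_symm, Complex.conj_re]
    -- Testing `T v` against `w - z` cancels the cross terms, so `w` and `z` need not be orthogonal.
    have hkey : (inner ℂ (T v) (w - z)).re =
        (inner ℂ (T w) w).re - (inner ℂ (T z) z).re := by
      rw [hv, map_add]
      simp only [inner_add_left, inner_sub_right, Complex.add_re, Complex.sub_re, hcross]
      ring
    have h3 : (inner ℂ (T v) (w - z)).re ≤ ‖T v‖ * (‖w‖ + ‖z‖) :=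
      ((Complex.re_le_norm _).trans (norm_inner_le_norm _ _)).trans
        (mul_le_mul_of_nonneg_left (norm_sub_le _ _) (norm_nonneg _))
    have h4 : ‖v‖ ≤ ‖w‖ + ‖z‖ := hv ▸ norm_add_le w z
    rcases (by positivity : 0 ≤ ‖w‖ + ‖z‖).eq_or_lt with h0 | h0
    · rw [← h0] at h4
      nlinarith [norm_nonneg (T v), norm_nonneg v]
    · have h5 : δ / 2 * (‖w‖ + ‖z‖) * (‖w‖ + ‖z‖) ≤ ‖T v‖ * (‖w‖ + ‖z‖) := by
        nlinarith [mul_nonneg hδ.le (sq_nonneg (‖w‖ - ‖z‖))]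
      have h6 := le_of_mul_le_mul_right h5 h0
      nlinarith
  -- The lower bound gives injectivity and closed range; for a self-adjoint operator, injectivity
  -- makes the range dense.
  have hunit : IsUnit T := by
    rw [ContinuousLinearMap.isUnit_iff_bijective,
      ContinuousLinearMap.bijective_iff_dense_range_and_antilipschitz]
    have hanti : AntilipschitzWith (Real.toNNReal (δ / 2))⁻¹ T := by
      refine T.antilipschitz_of_bound fun v => ?_
      rw [NNReal.coe_inv, Real.coe_toNNReal _ (by positivity), le_inv_mul_iff₀ (by positivity)]
      exact hbelow v
    refine ⟨?_, _, hanti⟩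
    rw [Submodule.topologicalClosure_eq_top_iff, ContinuousLinearMap.IsStarNormal.orthogonal_range hT.isStarNormal]
    exact LinearMap.ker_eq_bot.2 hanti.injective
  rw [spectrum.notMem_iff, ← neg_sub]
  exact hunit.neg

/-! ### Decomposition of sequences into cells -/

/-- The Euclidean space of `p` consecutive vectors of `ℂᵐ`. -/
abbrev CellSpace (m p : ℕ) : Type := PiLp 2 fun _ : Fin p => EuclideanSpace ℂ (Fin m)

/-- The entries of the sequence `v` at the sites `N + p k, …, N + p k + (p - 1)`. -/
noncomputable def SeqSpace.cell {m : ℕ} (p : ℕ) (N : ℤ) (v : SeqSpace m) (k : ℤ) :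
    CellSpace m p :=
  WithLp.toLp 2 fun i => v (N + k * p + (i : ℕ))

namespace SeqSpace

variable {m p : ℕ}

@[simp]
theorem cell_apply (N : ℤ) (v : SeqSpace m) (k : ℤ) (i : Fin p) :
    cell p N v k i = v (N + k * p + (i : ℕ)) := rfl

theorem cell_sub (N : ℤ) (v w : SeqSpace m) (k : ℤ) :
    cell p N (v - w) k = cell p N v k - cell p N w k := by
  ext i : 1
  simp

/-- The bijection between the sites and the pairs of a cell and a position in it. -/
def siteEquiv (p : ℕ) [NeZero p] (N : ℤ) : ℤ × Fin p ≃ ℤ :=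
  (Int.divModEquiv p).symm.trans (Equiv.addLeft N)

theorem siteEquiv_apply [NeZero p] (N k : ℤ) (i : Fin p) :
    siteEquiv p N (k, i) = N + k * p + (i : ℕ) := by
  simp [siteEquiv, add_assoc]

theorem hasSum_cells [NeZero p] {V : Type*} [AddCommGroup V] [TopologicalSpace V]
    [IsTopologicalAddGroup V] [RegularSpace V] (N : ℤ) {f : ℤ → V} {s : V} (hf : HasSum f s) :
    HasSum (fun k : ℤ => ∑ i : Fin p, f (N + k * p + (i : ℕ))) s := by
  have h := ((siteEquiv p N).hasSum_iff.2 hf).prod_fiberwise fun k => hasSum_fintype _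
  simpa [siteEquiv_apply] using h

theorem hasSum_inner_cell [NeZero p] (N : ℤ) (v w : SeqSpace m) :
    HasSum (fun k => inner ℂ (cell p N v k) (cell p N w k)) (inner ℂ v w) := by
  have hs : HasSum (fun n => inner ℂ (v n) (w n)) (inner ℂ v w) := lp.hasSum_inner v w
  have h := hasSum_cells (p := p) N hs
  exact h.congr_fun fun k => PiLp.inner_apply _ _

theorem hasSum_re_inner_cell [NeZero p] (N : ℤ) (v w : SeqSpace m) :
    HasSum (fun k => (inner ℂ (cell p N v k) (cell p N w k)).re) (inner ℂ v w).re :=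
  Complex.hasSum_re (hasSum_inner_cell N v w)

theorem hasSum_norm_sq_cell [NeZero p] (N : ℤ) (v : SeqSpace m) :
    HasSum (fun k => ‖cell p N v k‖ ^ 2) (‖v‖ ^ 2) := by
  have h := hasSum_re_inner_cell (p := p) N v v
  simp only [inner_self_eq_norm_sq_to_K] at h
  exact_mod_cast h

/-- Square summability survives because `q` is bounded on the finite-dimensional cell, with the same
bound in every cell. -/
theorem exists_cell_eq [NeZero p] (N : ℤ) (q : CellSpace m p →ₗ[ℂ] CellSpace m p)
    (v : SeqSpace m) : ∃ w : SeqSpace m, ∀ k, cell p N w k = q (cell p N v k) := by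
  set g : ℤ × Fin p → EuclideanSpace ℂ (Fin m) := fun z => q (cell p N v z.1) z.2 with hg
  have hfib : ∀ k, ∑ i, ‖g (k, i)‖ ^ 2 = ‖q (cell p N v k)‖ ^ 2 := fun k => by
    exact (PiLp.norm_sq_eq_of_L2 _ (q (cell p N v k))).symm
  have hsum : Summable fun z => ‖g z‖ ^ 2 := by
    rw [summable_prod_of_nonneg fun z => by positivity]
    refine ⟨fun k => Summable.of_finite, ?_⟩
    simp only [tsum_fintype, hfib]
    obtain ⟨C, hC⟩ := q.exists_norm_apply_le
    refine Summable.of_nonneg_of_le (fun k => by positivity) (fun k => ?_)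
      ((hasSum_norm_sq_cell (p := p) N v).summable.mul_left (C ^ 2))
    rw [← mul_pow]
    exact pow_le_pow_left₀ (norm_nonneg _) (hC _) 2
  refine ⟨⟨fun n => g ((siteEquiv p N).symm n), memℓp_gen ?_⟩, fun k => ?_⟩
  · have h := (siteEquiv p N).symm.summable_iff.2 hsum
    simp only [ENNReal.toReal_ofNat, Real.rpow_ofNat]
    exact h
  · ext i : 1
    change g ((siteEquiv p N).symm (N + k * p + (i : ℕ))) = _
    rw [← siteEquiv_apply, Equiv.symm_apply_apply]

end SeqSpace

/-! ### The Jacobi operator in terms of cells -/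

/-- The block of the Jacobi matrix that belongs to a cell of `p` sites starting at `N`. -/
noncomputable def jacobiBlock {m p : ℕ} (a b : ℤ → Matrix (Fin m) (Fin m) ℂ) (N : ℤ)
    (i j : Fin p) : Matrix (Fin m) (Fin m) ℂ :=
  (if (i : ℕ) + 1 = j then a (N + (i : ℕ)) else 0) + (if i = j then b (N + (i : ℕ)) else 0) +
    (if (j : ℕ) + 1 = i then (a (N + (j : ℕ)))ᴴ else 0)

theorem conjTranspose_jacobiBlock {m p : ℕ} {a b : ℤ → Matrix (Fin m) (Fin m) ℂ}
    (hb : ∀ n, (b n).IsHermitian) (N : ℤ) (i j : Fin p) :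
    (jacobiBlock a b N i j)ᴴ = jacobiBlock a b N j i := by
  simp only [jacobiBlock, Matrix.conjTranspose_add, apply_ite Matrix.conjTranspose,
    Matrix.conjTranspose_conjTranspose, Matrix.conjTranspose_zero, (hb _).eq, eq_comm (a := i)]
  by_cases h : j = i
  · subst h; simp
  · simp only [h, if_false]; abel

/-- The Jacobi operator restricted to a cell of `p` sites starting at `N`. -/
noncomputable def cellOperator {m p : ℕ} (a b : ℤ → Matrix (Fin m) (Fin m) ℂ) (N : ℤ) :
    CellSpace m p →ₗ[ℂ] CellSpace m p where
  toFun c := WithLp.toLp 2 fun i =>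
    ∑ j, Matrix.toEuclideanCLM (𝕜 := ℂ) (jacobiBlock a b N i j) (c j)
  map_add' c d := by ext i : 1; simp [Finset.sum_add_distrib]
  map_smul' r c := by ext i : 1; simp [Finset.smul_sum]

theorem isSymmetric_cellOperator {m p : ℕ} {a b : ℤ → Matrix (Fin m) (Fin m) ℂ}
    (hb : ∀ n, (b n).IsHermitian) (N : ℤ) :
    (cellOperator (p := p) a b N).IsSymmetric := by
  intro c d
  simp only [cellOperator, LinearMap.coe_mk, AddHom.coe_mk]
  rw [PiLp.inner_apply, PiLp.inner_apply]
  simp only [sum_inner, inner_sum]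
  rw [Finset.sum_comm]
  refine Finset.sum_congr rfl fun i _ => Finset.sum_congr rfl fun j _ => ?_
  rw [← conjTranspose_jacobiBlock hb, Matrix.inner_toEuclideanCLM_conjTranspose]

theorem cellOperator_apply {m p : ℕ} (a b : ℤ → Matrix (Fin m) (Fin m) ℂ) (N : ℤ)
    (c : CellSpace m p) (i : Fin p) :
    cellOperator a b N c i =
      (if h : (i : ℕ) + 1 < p then Matrix.toEuclideanCLM (𝕜 := ℂ) (a (N + (i : ℕ)))
        (c ⟨i + 1, h⟩) else 0) +
      Matrix.toEuclideanCLM (𝕜 := ℂ) (b (N + (i : ℕ))) (c i) +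
      (if 0 < (i : ℕ) then Matrix.toEuclideanCLM (𝕜 := ℂ) (a (N + (i : ℕ) - 1))ᴴ
        (c ⟨i - 1, by omega⟩) else 0) := by
  simp only [cellOperator, LinearMap.coe_mk, AddHom.coe_mk, jacobiBlock, map_add,
    add_apply, Finset.sum_add_distrib]
  congr 1
  · congr 1
    · split_ifs with h
      · rw [Finset.sum_eq_single ⟨i + 1, h⟩]
        · simp
        · intro j _ hj
          rw [if_neg fun h' => hj (Fin.ext h'.symm)]
          simp
        · simp
      · refine Finset.sum_eq_zero fun j _ => ?_
        rw [if_neg fun h' => h (by omega)]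
        simp
    · rw [Finset.sum_eq_single i]
      · simp
      · intro j _ hj
        rw [if_neg hj.symm]
        simp
      · simp
  · split_ifs with h
    · rw [Finset.sum_eq_single ⟨i - 1, by omega⟩]
      · rw [if_pos (by simp only; omega)]
        have : N + (i : ℕ) - 1 = N + ((i - 1 : ℕ) : ℤ) := by omega
        rw [this]
      · intro j _ hj
        rw [if_neg fun h' => hj (Fin.ext (by simp only; omega))]
        simp
      · simp
    · refine Finset.sum_eq_zero fun j _ => ?_
      rw [if_neg (by omega)]
      simp

theorem CellSpace.inner_single_left {m p : ℕ} (i : Fin p) (a : EuclideanSpace ℂ (Fin m))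
    (c : CellSpace m p) : inner ℂ (PiLp.single 2 i a : CellSpace m p) c = inner ℂ a (c i) := by
  rw [PiLp.inner_apply, Finset.sum_eq_single i]
  · simp
  · intro j _ hj
    rw [PiLp.single_eq_of_ne 2 hj, inner_zero_left]
  · simp

/-- Here `F k` is the energy inside cell `k` and `X k` that of the bond from cell `k` to cell `k +
1`. Each bond is seen from both of its cells, hence `2 * X k` in the sum. The bound involves `g` in
the left cell and `f` in the right one; summation over `ℤ` absorbs the shift. -/
theorem tsum_sub_le_and_le_tsum_add {F X f g : ℤ → ℝ} {t : ℝ} (hF : Summable F)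
    (hf : Summable f) (hg : Summable g) (hX : ∀ k, |2 * X k| ≤ f (k + 1) + g k)
    (ht : HasSum (fun k => F k + X k + X (k - 1)) t) :
    ∑' k, (F k - (f k + g k)) ≤ t ∧ t ≤ ∑' k, (F k + (f k + g k)) := by
  have hf' : Summable fun k => f (k + 1) := (Equiv.addRight (1 : ℤ)).summable_iff.2 hf
  have hSX : Summable fun k => 2 * X k := Summable.of_norm_bounded (hf'.add hg) hX
  have hSX' : Summable X := (summable_mul_left_iff two_ne_zero).1 hSX
  have hSX'' : HasSum (fun k => X (k - 1)) (∑' k, X k) :=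
    (Equiv.subRight (1 : ℤ)).hasSum_iff.2 hSX'.hasSum
  rw [ht.unique ((hF.hasSum.add hSX'.hasSum).add hSX'')]
  have hf'' : ∑' k, f (k + 1) = ∑' k, f k := (Equiv.addRight (1 : ℤ)).tsum_eq f
  have hup := hSX.tsum_le_tsum (fun k => (le_abs_self _).trans (hX k)) (hf'.add hg)
  have hlo := hSX.neg.tsum_le_tsum (fun k => (neg_le_abs _).trans (hX k)) (hf'.add hg)
  rw [hf'.tsum_add hg, hf''] at hup hlo
  rw [tsum_neg] at hlo
  rw [tsum_mul_left] at hup hlo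
  rw [hF.tsum_sub (hf.add hg), hF.tsum_add (hf.add hg), hf.tsum_add hg]
  constructor <;> linarith

namespace SeqSpace

variable {m p : ℕ} [NeZero p]

theorem summable_re_inner_cell (N : ℤ) (q : CellSpace m p →ₗ[ℂ] CellSpace m p)
    (v : SeqSpace m) : Summable fun k => (inner ℂ (q (cell p N v k)) (cell p N v k)).re := by
  obtain ⟨w, hw⟩ := exists_cell_eq N q v
  simpa only [hw] using (hasSum_re_inner_cell (p := p) N w v).summable

/-- The last position in a cell. -/
def lastSite (p : ℕ) [NeZero p] : Fin p := ⟨p - 1, Nat.sub_lt (NeZero.pos p) one_pos⟩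

/-- Cells start at `n + 1`, so their last site is congruent to `n` modulo `p`, and by periodicity
every bond between neighbouring cells carries `a n`. For `p = 1` both correction terms sit at the
same site. -/
theorem cell_jacobiOperator (hp : 0 < p) (a b : ℤ → Matrix (Fin m) (Fin m) ℂ)
    (ha : Function.Periodic a (p : ℤ)) (hb : Function.Periodic b (p : ℤ)) (n : ℤ)
    (v : SeqSpace m) (k : ℤ) :
    cell p (n + 1) (jacobiOperator p hp a b ha hb v) k =
      cellOperator a b (n + 1) (cell p (n + 1) v k) +
      PiLp.single 2 (lastSite p) (Matrix.toEuclideanCLM (𝕜 := ℂ) (a n) (cell p (n + 1) v (k + 1) 0)) +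
      PiLp.single 2 0
        (Matrix.toEuclideanCLM (𝕜 := ℂ) (a n)ᴴ (cell p (n + 1) v (k - 1) (lastSite p))) := by
  have ha' : ∀ x, a (x + k * p) = a x := fun x => ha.int_mul k x
  have hb' : ∀ x, b (x + k * p) = b x := fun x => hb.int_mul k x
  ext i : 1
  rw [PiLp.add_apply, PiLp.add_apply, cellOperator_apply, PiLp.single_apply, PiLp.single_apply,
    cell_apply]
  have hJ : ∀ x, jacobiOperator p hp a b ha hb v x =
      Matrix.toEuclideanCLM (𝕜 := ℂ) (a (x - 1))ᴴ (v (x - 1)) +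
      Matrix.toEuclideanCLM (𝕜 := ℂ) (b x) (v x) +
      Matrix.toEuclideanCLM (𝕜 := ℂ) (a x) (v (x + 1)) := fun x => by
    ext1
    rw [jacobiOperator_apply]
    rfl
  have e1 : a (n + 1 + k * p + (i : ℕ)) = a (n + 1 + (i : ℕ)) := by rw [← ha' (n + 1 + (i : ℕ))]; ring_nf
  have e2 : b (n + 1 + k * p + (i : ℕ)) = b (n + 1 + (i : ℕ)) := by rw [← hb' (n + 1 + (i : ℕ))]; ring_nf
  have e3 : a (n + 1 + k * p + (i : ℕ) - 1) = a (n + 1 + (i : ℕ) - 1) := by rw [← ha' (n + 1 + (i : ℕ) - 1)]; ring_nf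
  rw [hJ, e1, e2, e3]
  have h0 : ((0 : Fin p) : ℕ) = 0 := Fin.val_eq_zero_iff.2 rfl
  have hright : Matrix.toEuclideanCLM (𝕜 := ℂ) (a (n + 1 + (i : ℕ)))
        (v (n + 1 + k * p + (i : ℕ) + 1)) =
      (if h : (i : ℕ) + 1 < p then Matrix.toEuclideanCLM (𝕜 := ℂ) (a (n + 1 + (i : ℕ)))
        (cell p (n + 1) v k ⟨i + 1, h⟩) else 0) +
      (if i = lastSite p then
        Matrix.toEuclideanCLM (𝕜 := ℂ) (a n) (cell p (n + 1) v (k + 1) 0) else 0) := by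
    by_cases h : (i : ℕ) + 1 < p
    · have h' : i ≠ lastSite p := fun h' => by
        have := congrArg Fin.val h'
        simp only [lastSite] at this
        omega
      have ev : n + 1 + k * p + (i : ℕ) + 1 = n + 1 + k * p + ((i + 1 : ℕ) : ℤ) := by
        push_cast; ring
      rw [dif_pos h, if_neg h', add_zero, cell_apply, ev]
    · have h' : i = lastSite p := Fin.ext (by simp only [lastSite]; omega)
      have hi : ((i : ℕ) : ℤ) = p - 1 := by omega
      have ea : a (n + 1 + (i : ℕ)) = a n := by rw [← ha n, hi]; congr 1; ring
      have ev : n + 1 + k * p + (i : ℕ) + 1 = n + 1 + (k + 1) * p + ((0 : Fin p) : ℕ) := by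
        rw [h0, hi]; push_cast; ring
      rw [dif_neg h, if_pos h', zero_add, cell_apply, ea, ev]
  have hleft : Matrix.toEuclideanCLM (𝕜 := ℂ) (a (n + 1 + (i : ℕ) - 1))ᴴ
        (v (n + 1 + k * p + (i : ℕ) - 1)) =
      (if 0 < (i : ℕ) then Matrix.toEuclideanCLM (𝕜 := ℂ) (a (n + 1 + (i : ℕ) - 1))ᴴ
        (cell p (n + 1) v k ⟨i - 1, by omega⟩) else 0) +
      (if i = 0 then
        Matrix.toEuclideanCLM (𝕜 := ℂ) (a n)ᴴ (cell p (n + 1) v (k - 1) (lastSite p)) else 0) := by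
    by_cases h : 0 < (i : ℕ)
    · have h' : i ≠ 0 := fun h' => by simp [h'] at h
      have ev : n + 1 + k * p + (i : ℕ) - 1 = n + 1 + k * p + ((i - 1 : ℕ) : ℤ) := by omega
      rw [if_pos h, if_neg h', add_zero, cell_apply, ev]
    · have h' : i = 0 := Fin.ext (by rw [h0]; omega)
      have hi : ((i : ℕ) : ℤ) = 0 := by omega
      have hl : ((lastSite p : ℕ) : ℤ) = p - 1 := by simp only [lastSite]; omega
      have ea : a (n + 1 + (i : ℕ) - 1) = a n := by rw [hi]; congr 1; ring
      have ev : n + 1 + k * p + (i : ℕ) - 1 = n + 1 + (k - 1) * p + (lastSite p : ℕ) := by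
        rw [hi, hl]; ring
      rw [if_neg h, if_pos h', zero_add, cell_apply, ea, ev]
  rw [hright, hleft, cell_apply (n + 1) v k i]
  abel

/-- Cutting the bond `n` bounds the Jacobi operator from both sides by block diagonal operators,
which are on different sides of `x` except for `x` in a set of measure at most `4 Tr |a n|`. -/
theorem exists_cell_bounds (hp : 0 < p) {a b : ℤ → Matrix (Fin m) (Fin m) ℂ}
    (ha : Function.Periodic a (p : ℤ)) (hb : Function.Periodic b (p : ℤ))
    (hb' : ∀ n, (b n).IsHermitian) (n : ℤ) :
    ∃ S T : CellSpace m p →ₗ[ℂ] CellSpace m p,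
      (∃ B : Set ℝ, volume B ≤ ENNReal.ofReal (4 * traceAbs (a n)) ∧
        ∀ x ∉ B, ∃ q : CellSpace m p →ₗ[ℂ] CellSpace m p, ∃ δ > 0, ∀ c,
          δ * ‖q c‖ ^ 2 ≤ (inner ℂ (S (q c)) (q c)).re - x * ‖q c‖ ^ 2 ∧
          (inner ℂ (T (c - q c)) (c - q c)).re - x * ‖c - q c‖ ^ 2 ≤ -(δ * ‖c - q c‖ ^ 2)) ∧
      ∀ v : SeqSpace m,
        ∑' k, (inner ℂ (S (cell p (n + 1) v k)) (cell p (n + 1) v k)).re ≤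
          (inner ℂ (jacobiOperator p hp a b ha hb v) v).re ∧
        (inner ℂ (jacobiOperator p hp a b ha hb v) v).re ≤
          ∑' k, (inner ℂ (T (cell p (n + 1) v k)) (cell p (n + 1) v k)).re := by
  obtain ⟨s, u, w, hs, hsum, hu, hw, hcut⟩ := exists_abs_re_inner_le_traceAbs (a n)
  have hA := isSymmetric_cellOperator (p := p) (a := a) hb' (n + 1)
  set A := cellOperator (p := p) a b (n + 1)
  -- In the form of `a n`, the right singular vectors `u` pair with the first site of the next cell,
  -- the left ones `w` with the last site of the present cell.
  obtain ⟨D₀, D₁, hq₀, hq₁, hB⟩ := hA.exists_splitting_of_perturbation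
    (u := fun j => (PiLp.single 2 0 (u j) : CellSpace m p))
    (w := fun j => (PiLp.single 2 (lastSite p) (w j) : CellSpace m p)) hs
    (fun j => (PiLp.norm_single 2 _ _ _).trans_le (hu j))
    (fun j => (PiLp.norm_single 2 _ _ _).trans_le (hw j))
  rw [hsum] at hB
  simp only [CellSpace.inner_single_left] at hq₀ hq₁
  have hsub : ∀ c, (inner ℂ ((A - (D₀ + D₁)) c) c).re =
      (inner ℂ (A c) c).re - ((inner ℂ (D₀ c) c).re + (inner ℂ (D₁ c) c).re) := fun c => by
    simp only [LinearMap.sub_apply, LinearMap.add_apply, inner_sub_left, inner_add_left,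
      Complex.sub_re, Complex.add_re]
  have hadd : ∀ c, (inner ℂ ((A + (D₀ + D₁)) c) c).re =
      (inner ℂ (A c) c).re + ((inner ℂ (D₀ c) c).re + (inner ℂ (D₁ c) c).re) := fun c => by
    simp only [LinearMap.add_apply, inner_add_left, Complex.add_re]
  refine ⟨A - (D₀ + D₁), A + (D₀ + D₁), hB, fun v => ?_⟩
  simp only [hsub, hadd]
  have hJ : ∀ k, (inner ℂ (cell p (n + 1) (jacobiOperator p hp a b ha hb v) k)
      (cell p (n + 1) v k)).re =
      (inner ℂ (A (cell p (n + 1) v k)) (cell p (n + 1) v k)).re +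
      (inner ℂ (Matrix.toEuclideanCLM (𝕜 := ℂ) (a n) (cell p (n + 1) v (k + 1) 0))
        (cell p (n + 1) v k (lastSite p))).re +
      (inner ℂ (Matrix.toEuclideanCLM (𝕜 := ℂ) (a n) (cell p (n + 1) v (k - 1 + 1) 0))
        (cell p (n + 1) v (k - 1) (lastSite p))).re := fun k => by
    rw [cell_jacobiOperator, inner_add_left, inner_add_left, CellSpace.inner_single_left,
      CellSpace.inner_single_left, Matrix.inner_toEuclideanCLM_conjTranspose, Complex.add_re,
      Complex.add_re, sub_add_cancel, ← inner_conj_symm (cell p (n + 1) v (k - 1) (lastSite p)),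
      Complex.conj_re]
  have hsumJ := hasSum_re_inner_cell (p := p) (n + 1) (jacobiOperator p hp a b ha hb v) v
  simp only [hJ] at hsumJ
  refine tsum_sub_le_and_le_tsum_add (summable_re_inner_cell (n + 1) A v)
    (summable_re_inner_cell (n + 1) D₀ v) (summable_re_inner_cell (n + 1) D₁ v)
    (X := fun k => (inner ℂ (Matrix.toEuclideanCLM (𝕜 := ℂ) (a n) (cell p (n + 1) v (k + 1) 0))
        (cell p (n + 1) v k (lastSite p))).re) (fun k => ?_) hsumJ
  rw [hq₀, hq₁]
  exact hcut _ _

end SeqSpace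

/-! ### The upper bound -/

open SeqSpace in
-- The operators `S` and `T` are the same in all cells, so one `q` and one `δ` work everywhere and
-- the cell inequalities can be summed.
theorem spectrumMeasure_jacobiOperator_le {m p : ℕ} (hp : 0 < p)
    {a b : ℤ → Matrix (Fin m) (Fin m) ℂ}
    (ha : Function.Periodic a (p : ℤ)) (hb : Function.Periodic b (p : ℤ))
    (hb' : ∀ n, (b n).IsHermitian) (n : ℤ) :
    spectrumMeasure (jacobiOperator p hp a b ha hb) ≤ ENNReal.ofReal (4 * traceAbs (a n)) := by
  have : NeZero p := ⟨hp.ne'⟩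
  obtain ⟨S, T, ⟨B, hB, hBq⟩, hJ⟩ := exists_cell_bounds hp ha hb hb' n
  refine (measure_mono fun x hx => ?_).trans hB
  by_contra hxB
  obtain ⟨q, δ, hδ, hq⟩ := hBq x hxB
  refine (isSelfAdjoint_jacobiOperator p hp a b ha hb hb').notMem_spectrum_of_splitting hδ
    (fun v => ?_) hx
  obtain ⟨w, hw⟩ := exists_cell_eq (n + 1) q v
  refine ⟨w, ?_, ?_⟩
  · have h1 := hasSum_norm_sq_cell (p := p) (n + 1) w
    have h2 := (summable_re_inner_cell (n + 1) S w).hasSum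
    have h3 := hasSum_le (fun k => ?_) (h1.mul_left δ) (h2.sub (h1.mul_left x))
    · linarith [(hJ w).1]
    · rw [hw]
      exact (hq _).1
  · have h1 := hasSum_norm_sq_cell (p := p) (n + 1) (v - w)
    have h2 := (summable_re_inner_cell (n + 1) T (v - w)).hasSum
    have h3 := hasSum_le (fun k => ?_) (h2.sub (h1.mul_left x)) (h1.mul_left δ).neg
    · linarith [(hJ (v - w)).2]
    · rw [cell_sub, hw]
      exact (hq _).2

/-! ### Sharpness: the spectral bands of the example -/

/-- A scalar sequence tending to `0` that solves `g (n + 2) + g n = (z + z⁻¹) g (n + 1)` with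
`|z| = 1` vanishes. -/
theorem eq_zero_of_recurrence_of_tendsto {g : ℕ → ℂ} {z : ℂ} (hz : ‖z‖ = 1)
    (hrec : ∀ n, g (n + 2) + g n = (z + z⁻¹) * g (n + 1))
    (hlim : Filter.Tendsto g Filter.atTop (nhds 0)) (n : ℕ) : g n = 0 := by
  have hz0 : z ≠ 0 := fun h => by simp [h] at hz
  have hzz : z * z⁻¹ = 1 := mul_inv_cancel₀ hz0
  -- `Q` is a conserved quantity of the recurrence and tends to `0`, so it vanishes. Each step then
  -- multiplies `g` by `z` or `z⁻¹`, and `‖g n‖` is constant. The argument includes the band edges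
  -- `z = z⁻¹`.
  set Q : ℕ → ℂ := fun n => (g (n + 1) - z * g n) * (g (n + 1) - z⁻¹ * g n) with hQ
  have hQstep : ∀ n, Q (n + 1) = Q n := fun n => by
    have h : g (n + 2) = (z + z⁻¹) * g (n + 1) - g n := eq_sub_of_add_eq (hrec n)
    simp only [hQ]
    rw [show n + 1 + 1 = n + 2 from rfl, h]
    linear_combination (g (n + 1) ^ 2 - g n ^ 2) * hzz
  have hQconst : ∀ n, Q n = Q 0 := fun n => by
    induction n with
    | zero => rfl
    | succ k ih => rw [hQstep, ih]
  have hlim1 := hlim.comp (Filter.tendsto_add_atTop_nat 1)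
  have hQlim : Filter.Tendsto Q Filter.atTop (nhds 0) := by
    simpa using (hlim1.sub (hlim.const_mul z)).mul (hlim1.sub (hlim.const_mul z⁻¹))
  have hQ0 : ∀ n, Q n = 0 := fun n => by
    rw [hQconst]
    exact tendsto_nhds_unique (tendsto_const_nhds.congr fun n => (hQconst n).symm) hQlim
  have hnorm : ∀ n, ‖g (n + 1)‖ = ‖g n‖ := fun n => by
    rcases mul_eq_zero.1 (hQ0 n) with h | h
    · rw [sub_eq_zero.1 h, norm_mul, hz, one_mul]
    · rw [sub_eq_zero.1 h, norm_mul, norm_inv, hz, inv_one, one_mul]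
  have hconst : ∀ k, ‖g (n + k)‖ = ‖g n‖ := fun k => by
    induction k with
    | zero => rfl
    | succ k ih => rw [← add_assoc, hnorm, ih]
  have h1 : Filter.Tendsto (fun k => ‖g (n + k)‖) Filter.atTop (nhds 0) := by
    have := (hlim.comp (Filter.tendsto_add_atTop_nat n)).norm
    simpa [Function.comp_def, add_comm] using this
  exact norm_eq_zero.1 (tendsto_nhds_unique (tendsto_const_nhds.congr fun k => (hconst k).symm) h1)

theorem SeqSpace.tendsto_cofinite_zero {m : ℕ} (v : SeqSpace m) :
    Filter.Tendsto (fun n => v n) Filter.cofinite (nhds 0) := by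
  have h := (lp.hasSum_norm (by norm_num) v).summable.tendsto_cofinite_zero
  rw [tendsto_zero_iff_norm_tendsto_zero]
  simp only [ENNReal.toReal_ofNat, Real.rpow_ofNat] at h
  have h2 := h.sqrt
  simpa [Real.sqrt_sq (norm_nonneg _)] using h2

/-- Surjectivity of `μ - J` fails: a preimage of the unit vector at site `0` in direction `k` would
have a `k`-th component that solves the free recurrence on both half-lines and decays. It then
vanishes everywhere, contradicting the equation at site `0`. -/
theorem mem_spectrum_jacobiOperator_diagonal {m p : ℕ} (hp : 0 < p)
    {a b : ℤ → Matrix (Fin m) (Fin m) ℂ}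
    (ha : Function.Periodic a (p : ℤ)) (hb : Function.Periodic b (p : ℤ)) (ha1 : ∀ n, a n = 1)
    {d : Fin m → ℂ} (hbd : ∀ n, b n = Matrix.diagonal d) (k : Fin m) {z : ℂ} (hz : ‖z‖ = 1) :
    d k + (z + z⁻¹) ∈ spectrum ℂ (jacobiOperator p hp a b ha hb) := by
  set J := jacobiOperator p hp a b ha hb with hJ
  set μ := d k + (z + z⁻¹) with hμ
  intro hunit
  obtain ⟨G, hG⟩ := (ContinuousLinearMap.isUnit_iff_bijective.1 hunit).2
    (lp.single 2 (0 : ℤ) (EuclideanSpace.single k (1 : ℂ)))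
  set g : ℤ → ℂ := fun n => G n k with hg
  have hlim : Filter.Tendsto g Filter.cofinite (nhds 0) := by
    rw [tendsto_zero_iff_norm_tendsto_zero]
    exact squeeze_zero (fun n => norm_nonneg _) (fun n => PiLp.norm_apply_le (G n) k)
      (tendsto_zero_iff_norm_tendsto_zero.1 G.tendsto_cofinite_zero)
  have hrec : ∀ n, (z + z⁻¹) * g n - (g (n - 1) + g (n + 1)) = if n = 0 then 1 else 0 := by
    intro n
    have h1 : ((algebraMap ℂ (SeqSpace m →L[ℂ] SeqSpace m) μ - J) G) n k =
        μ * g n - (g (n - 1) + d k * g n + g (n + 1)) := by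
      have h2 : (J G n) k = g (n - 1) + d k * g n + g (n + 1) := by
        have := congrFun (jacobiOperator_apply p hp a b ha hb G n) k
        rw [ha1, ha1, hbd] at this
        simpa [Matrix.mulVec_diagonal] using this
      rw [← h2]
      simp only [Algebra.algebraMap_eq_smul_one, sub_apply, smul_apply, one_apply_eq_self]
      rfl
    rw [hG] at h1
    have h3 : ((lp.single 2 (0 : ℤ) (EuclideanSpace.single k (1 : ℂ)) : SeqSpace m) n) k =
        if n = 0 then 1 else 0 := by
      by_cases hn : n = 0
      · subst hn; simp
      · simp [hn]
    rw [h3] at h1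
    rw [h1, hμ]
    ring
  have hpos : ∀ n : ℕ, g n = 0 := by
    refine eq_zero_of_recurrence_of_tendsto (g := fun n : ℕ => g n) hz (fun n => ?_)
      ((Nat.cofinite_eq_atTop ▸ hlim.comp Nat.cast_injective.tendsto_cofinite))
    have := hrec ((n : ℤ) + 1)
    rw [if_neg (by omega)] at this
    push_cast
    rw [show (n : ℤ) + 1 - 1 = n by ring, show (n : ℤ) + 1 + 1 = n + 2 by ring] at this
    linear_combination -this
  have hneg : ∀ n : ℕ, g (-n) = 0 := by
    refine eq_zero_of_recurrence_of_tendsto (g := fun n : ℕ => g (-n)) hz (fun n => ?_)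
      ((Nat.cofinite_eq_atTop ▸
        hlim.comp (neg_injective.comp Nat.cast_injective).tendsto_cofinite))
    have := hrec (-(n : ℤ) - 1)
    rw [if_neg (by omega)] at this
    push_cast
    rw [show -(n : ℤ) - 1 - 1 = -(n + 2) by ring, show -(n : ℤ) - 1 + 1 = -n by ring,
      show -(n : ℤ) - 1 = -(n + 1) by ring] at this
    linear_combination -this
  have h0 := hrec 0
  have e0 := hpos 0
  have e1 := hpos 1
  have e2 := hneg 1
  push_cast at e0 e1 e2
  simp [e0, e1, e2] at h0

theorem Complex.exists_norm_eq_one_add_inv_eq {t : ℝ} (h1 : -2 ≤ t) (h2 : t ≤ 2) :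
    ∃ z : ℂ, ‖z‖ = 1 ∧ z + z⁻¹ = t := by
  refine ⟨Complex.exp (Real.arccos (t / 2) * Complex.I), Complex.norm_exp_ofReal_mul_I _, ?_⟩
  rw [← Complex.exp_neg, ← neg_mul, ← Complex.two_cos, ← Complex.ofReal_cos,
    Real.cos_arccos (by linarith) (by linarith)]
  push_cast
  ring

theorem traceAbs_one (m : ℕ) : traceAbs (1 : Matrix (Fin m) (Fin m) ℂ) = m := by
  simp [traceAbs, CFC.sqrt_one]

theorem theorem1p2 :
    (∀ (m p : ℕ) (hp : 0 < p) (a b : ℤ → Matrix (Fin m) (Fin m) ℂ)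
      (ha : Function.Periodic a (p : ℤ)) (hb : Function.Periodic b (p : ℤ)),
      (∀ n, (b n).IsHermitian) →
      spectrumMeasure (jacobiOperator p hp a b ha hb) ≤
        ⨅ n : ℤ, ENNReal.ofReal (4 * traceAbs (a n))) ∧
    (∀ (m p : ℕ) (hp : 0 < p) (a b : ℤ → Matrix (Fin m) (Fin m) ℂ)
      (ha : Function.Periodic a (p : ℤ)) (hb : Function.Periodic b (p : ℤ)),
      (∀ n, a n = 1) →
      (∀ n, b n = Matrix.diagonal fun k : Fin m => 4 * ((k : ℂ) + 1)) →
      spectrumMeasure (jacobiOperator p hp a b ha hb) =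
        ⨅ n : ℤ, ENNReal.ofReal (4 * traceAbs (a n))) := by
  have hle : ∀ (m p : ℕ) (hp : 0 < p) (a b : ℤ → Matrix (Fin m) (Fin m) ℂ)
      (ha : Function.Periodic a (p : ℤ)) (hb : Function.Periodic b (p : ℤ)),
      (∀ n, (b n).IsHermitian) →
      spectrumMeasure (jacobiOperator p hp a b ha hb) ≤
        ⨅ n : ℤ, ENNReal.ofReal (4 * traceAbs (a n)) :=
    fun m p hp a b ha hb hb' => le_iInf fun n =>
      spectrumMeasure_jacobiOperator_le hp ha hb hb' n
  refine ⟨hle, fun m p hp a b ha hb ha1 hbd => le_antisymm (hle m p hp a b ha hb fun n => ?_) ?_⟩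
  · rw [hbd, Matrix.isHermitian_diagonal_iff]
    intro k
    rw [isSelfAdjoint_iff]
    simp
  · have hsub : Set.Ioc (2 : ℝ) (4 * m + 2) ⊆
        {x : ℝ | (x : ℂ) ∈ spectrum ℂ (jacobiOperator p hp a b ha hb)} := by
      rintro x ⟨hx1, hx2⟩
      -- The band number is `⌈(x - 2) / 4⌉`, shifted by 1 since `Fin m` starts at `0`. Excluding `x
      -- = 2` keeps the ceiling positive.
      obtain ⟨k, hk1, hk2⟩ : ∃ k : Fin m, 4 * (k : ℝ) + 2 ≤ x ∧ x ≤ 4 * (k : ℝ) + 6 := by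
        have hc0 : 0 < ⌈(x - 2) / 4⌉₊ := Nat.ceil_pos.2 (by linarith)
        have hcm : ⌈(x - 2) / 4⌉₊ ≤ m := Nat.ceil_le.2 (by linarith)
        have hlt := Nat.ceil_lt_add_one (show 0 ≤ (x - 2) / 4 by linarith)
        have hge := Nat.le_ceil ((x - 2) / 4)
        refine ⟨⟨⌈(x - 2) / 4⌉₊ - 1, by omega⟩, ?_, ?_⟩ <;>
          rw [Nat.cast_sub hc0, Nat.cast_one] <;> linarith
      obtain ⟨z, hz, hzt⟩ := Complex.exists_norm_eq_one_add_inv_eq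
        (t := x - 4 * ((k : ℝ) + 1)) (by linarith) (by linarith)
      have := mem_spectrum_jacobiOperator_diagonal hp ha hb ha1 hbd k hz
      rw [hzt] at this
      have hxk : 4 * ((k : ℂ) + 1) + ((x - 4 * ((k : ℝ) + 1) : ℝ) : ℂ) = x := by
        push_cast
        ring
      rw [Set.mem_ofPred_eq, ← hxk]
      exact this
    -- All terms of the infimum are equal to `4m`, so any index will do.
    refine (iInf_le _ 0).trans ?_
    rw [ha1, traceAbs_one]
    refine le_trans (le_of_eq ?_) (measure_mono hsub)
    rw [Real.volume_Ioc]
    congr 1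
    ring
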